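/- Let $G=(V,E)$ be a finite undirected graph, with loops and multiple edges allowed. Its dichromatic polynomial is $$Z_G(q,v)=\sum_{E'\subseteq E} q^{k(E')}\,v^{|E'|},$$ where $k(E')$ is the number of connected components (including isolated vertices) of the subgraph $(V,E')$. For integers $n,r\ge 1$ let $C_n^{(r)}$ be the cycle $C_n$ of length $n$ with each edge replaced by $r$ edges in parallel. Theorem. Fix complex numbers $q_0,v_0$ satisfying $q_0\ne 0$, $q_0\neq 1$ and $|1+v_0|\ge 1$. Then, for each $\epsilon>0$, there exist a number $r_0<\infty$ and, for each $r$, a number $n_0(r)<\infty$ such that for all $r\ge r_0$ and $n\ge n_0(r)$, the polynomial $Z_{C_n^{(r)}}(q_0,\,\cdot\,)$ has a zero in the disc $|v-v_0|<\epsilon$. -/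

import Mathlib

open scoped Graph

/-- The cycle `C_n` as a multigraph: vertices `0, …, n - 1`, and for each `i` one edge joining `i`
to its cyclic successor (a loop for `n = 1`, two parallel edges for `n = 2`). -/
def cycleMultigraph (n : ℕ) : Graph (Fin n) (Fin n) where
  vertexSet := Set.univ
  IsLink i x y := (x = i ∧ y = finRotate n i) ∨ (y = i ∧ x = finRotate n i)
  isLink_symm := fun _ _ => ⟨fun _ _ h => h.symm⟩
  eq_or_eq_of_isLink_of_isLink := by
    rintro i x y z w (⟨rfl, rfl⟩ | ⟨rfl, rfl⟩) (⟨rfl, rfl⟩ | ⟨rfl, rfl⟩) <;> simp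
  left_mem_of_isLink := fun _ _ _ _ => Set.mem_univ _

/-- The graph obtained from `G` by replacing each edge by `r` edges in parallel. -/
def Graph.parallelExpansion {α β : Type*} (G : Graph α β) (r : ℕ) : Graph α (β × Fin r) where
  vertexSet := V(G)
  IsLink e x y := G.IsLink e.1 x y
  isLink_symm := fun _ _ => ⟨fun _ _ h => h.symm⟩
  eq_or_eq_of_isLink_of_isLink := fun _ _ _ _ _ h h' => h.left_eq_or_eq h'
  left_mem_of_isLink := fun _ _ _ h => h.left_mem

/-- The number of connected components (including isolated vertices) of a multigraph: the number
of classes of the equivalence relation on the vertices generated by adjacency. -/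
noncomputable def Graph.componentCount {α β : Type*} (G : Graph α β) : ℕ :=
  Nat.card (Quot fun x y : V(G) => G.Adj x.1 y.1)

open Classical in
/-- The Potts-model partition function of a finite multigraph with edge weights `v`:
the sum over `A ⊆ E(G)` of `q ^ k(A) * ∏ e ∈ A, v e`, where `k(A)` is the number of connected
components of the spanning subgraph with edge set `A`. -/
noncomputable def Graph.pottsPartition {α β : Type*} [Finite α] [Fintype β] (G : Graph α β)
    (q : ℂ) (v : β → ℂ) : ℂ :=
  ∑ A ∈ E(G).toFinset.powerset, q ^ (G.restrict (A : Set β)).componentCount * ∏ e ∈ A, v e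

/-- The dichromatic polynomial `Z_G(q, v)`: all edge weights are equal to `v`. -/
noncomputable def Graph.dichromatic {α β : Type*} [Finite α] [Fintype β] (G : Graph α β)
    (q v : ℂ) : ℂ :=
  G.pottsPartition q fun _ => v

open Finset Filter Topology

/-! With `w = (1 + v) ^ r - 1`, `dichromatic_cycle_expansion` gives `Z = (q + w) ^ n + (q - 1) * w ^
n`. So, for `w ≠ 0`, zeros are solutions of `((q + w) / w) ^ n = 1 - q`. As `n` grows the `n`-th
roots of `1 - q` fill the unit circle, so zeros accumulate at the line `‖q + w‖ = ‖w‖`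
(`exists_zeros_tendsto_bisector`). In the variable `1 + w = (1 + v) ^ r` this line meets every large
circle, in particular that of radius `ρ ^ r` with `ρ > 1` just above `‖1 + v₀‖`. An `r`-th root with
argument within `π / r` of that of `1 + v₀` then lies near `1 + v₀`. -/

/-- A finset of pairs is the same as the family of its fibres over the first coordinate. -/
def finsetProdEquiv (β γ : Type*) [Fintype β] [Fintype γ] [DecidableEq β] [DecidableEq γ] :
    Finset (β × γ) ≃ (β → Finset γ) where
  toFun A i := univ.filter fun j => (i, j) ∈ A
  invFun f := univ.filter fun p => p.2 ∈ f p.1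
  left_inv A := by ext; simp
  right_inv f := by ext; simp

/-- Multiplicative functionals of the fibres sum to a power over all finsets of pairs. -/
theorem sum_finset_prod_fibres {β γ : Type*} [Fintype β] [Fintype γ] [DecidableEq β]
    [DecidableEq γ] (g : Finset γ → ℂ) :
    ∑ A : Finset (β × γ), ∏ i, g (finsetProdEquiv β γ A i) =
      (∑ S : Finset γ, g S) ^ Fintype.card β := by
  rw [(finsetProdEquiv β γ).sum_comp fun f => ∏ i, g (f i), ← Fintype.piFinset_univ,
    ← Finset.prod_univ_sum]
  simp

theorem pow_card_eq_prod_fibres {β γ : Type*} [Fintype β] [Fintype γ] [DecidableEq β]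
    [DecidableEq γ] (v : ℂ) (A : Finset (β × γ)) :
    v ^ #A = ∏ i, v ^ #(finsetProdEquiv β γ A i) := by
  rw [Finset.prod_pow_eq_pow_sum]
  congr 1
  simp only [finsetProdEquiv, Equiv.coe_fn_mk, Finset.card_filter]
  rw [← Fintype.sum_prod_type (f := fun p : β × γ => if p ∈ A then 1 else 0)]
  simp

theorem sum_pow_card_finset (γ : Type*) [Fintype γ] (v : ℂ) :
    ∑ S : Finset γ, v ^ #S = (1 + v) ^ Fintype.card γ := by
  have := Finset.prod_one_add (f := fun _ : γ => v) univ
  simpa using this.symm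

/-! ### Component counts on the cycle -/

section Components

variable {α : Type*} (s : α → α) (B : Set α)

/-- Joining each `x ∈ B` to `s x`: if every `s`-orbit leaves `B`, each class of the generated
equivalence relation contains exactly one point outside `B`. -/
theorem card_quot_of_orbits_leave (R : α → α → Prop)
    (hR : ∀ x y, R x y ↔ (x ∈ B ∧ y = s x) ∨ (y ∈ B ∧ x = s y))
    (h : ∀ x, ∃ k, s^[k] x ∉ B) : Nat.card (Quot R) = Nat.card (Bᶜ : Set α) := by
  classical
  -- The representative of a class is the first point outside `B` on the forward orbit.
  let f : α → (Bᶜ : Set α) := fun x => ⟨s^[Nat.find (h x)] x, Nat.find_spec (h x)⟩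
  have hstep : ∀ x ∈ B, f x = f (s x) := by
    intro x hx
    have : Nat.find (h x) = Nat.find (h (s x)) + 1 :=
      Nat.find_comp_succ (h x) (h (s x)) (by simpa using hx)
    apply Subtype.ext
    change s^[Nat.find (h x)] x = s^[Nat.find (h (s x))] (s x)
    rw [this, Function.iterate_succ_apply]
  have hfix : ∀ x (hx : x ∉ B), f x = ⟨x, hx⟩ := by
    intro x hx
    have : Nat.find (h x) = 0 := (Nat.find_eq_zero _).2 hx
    apply Subtype.ext
    change s^[Nat.find (h x)] x = x
    rw [this]; rfl
  have hquot : ∀ k x, (∀ j < k, s^[j] x ∈ B) → Quot.mk R (s^[k] x) = Quot.mk R x := by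
    intro k
    induction k with
    | zero => intro x _; rfl
    | succ k ih =>
      intro x hx
      rw [Function.iterate_succ_apply', ← ih x fun j hj => hx j (by omega)]
      exact Quot.sound ((hR _ _).2 (Or.inr ⟨hx k (by omega), rfl⟩))
  refine Nat.card_congr
    { toFun := Quot.lift f ?_
      invFun := fun x => Quot.mk R x
      left_inv := ?_
      right_inv := fun x => hfix x x.2 }
  · intro x y hxy
    rcases (hR x y).1 hxy with ⟨hx, rfl⟩ | ⟨hy, rfl⟩
    · exact hstep x hx
    · exact (hstep y hy).symm
  · rintro ⟨x⟩
    exact hquot _ x fun j hj => not_not.1 (Nat.find_min (h x) hj)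

theorem card_quot_of_transitive [Nonempty α] (R : α → α → Prop) (hR : ∀ x, R x (s x))
    (h : ∀ x y, ∃ k, s^[k] x = y) : Nat.card (Quot R) = 1 := by
  have hquot : ∀ k x, Quot.mk R (s^[k] x) = Quot.mk R x := by
    intro k
    induction k with
    | zero => intro x; rfl
    | succ k ih =>
      intro x
      rw [Function.iterate_succ_apply', ← ih x]
      exact (Quot.sound (hR _)).symm
  rw [Nat.card_eq_one_iff_unique]
  refine ⟨⟨?_⟩, ⟨Quot.mk R (Classical.arbitrary α)⟩⟩
  rintro ⟨x⟩ ⟨y⟩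
  obtain ⟨k, rfl⟩ := h x y
  exact (hquot k x).symm

end Components

open Fin.NatCast in
theorem exists_finRotate_iterate_eq {n : ℕ} (x y : Fin n) : ∃ k, (finRotate n)^[k] x = y := by
  obtain _ | n := n
  · exact x.elim0
  have : ∀ k : ℕ, (finRotate (n + 1))^[k] x = x + (k : Fin (n + 1)) := by
    intro k
    induction k with
    | zero => simp
    | succ k ih =>
      rw [Function.iterate_succ_apply', ih, finRotate_apply, Nat.cast_succ, add_assoc]
  exact ⟨(y - x : Fin (n + 1)).val, by rw [this]; simp⟩

/-- Each missing cycle edge ends one arc. With none missing there is still one component, not zero;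
this exception produces the term `(q - 1) * w ^ n`. -/
theorem componentCount_restrict_cycle_expansion {n r : ℕ} (hn : n ≠ 0)
    (A : Finset (Fin n × Fin r)) :
    (((cycleMultigraph n).parallelExpansion r).restrict (A : Set (Fin n × Fin r))).componentCount =
      if ∀ i, finsetProdEquiv _ _ A i ≠ ∅ then 1 else
        #(univ.filter fun i => finsetProdEquiv _ _ A i = ∅) := by
  set B : Set (Fin n) := {i | finsetProdEquiv _ _ A i ≠ ∅} with hB
  have hmem : ∀ i, i ∈ B ↔ ∃ j, (i, j) ∈ A := by
    intro i
    simp [hB, finsetProdEquiv, Finset.filter_eq_empty_iff]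
  have : NeZero n := ⟨hn⟩
  let R : Fin n → Fin n → Prop :=
    fun x y => (x ∈ B ∧ y = finRotate n x) ∨ (y ∈ B ∧ x = finRotate n y)
  have key : (((cycleMultigraph n).parallelExpansion r).restrict
      (A : Set (Fin n × Fin r))).componentCount = Nat.card (Quot R) := by
    refine Nat.card_congr (Quot.congr (Equiv.subtypeUnivEquiv fun _ => Set.mem_univ _) ?_)
    rintro ⟨x, hx⟩ ⟨y, hy⟩
    simp only [R, hmem]
    constructor
    · rintro ⟨⟨i, j⟩, hA, ⟨rfl, h⟩ | ⟨rfl, h⟩⟩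
      · exact Or.inl ⟨⟨j, hA⟩, h⟩
      · exact Or.inr ⟨⟨j, hA⟩, h⟩
    · rintro (⟨⟨j, hA⟩, h⟩ | ⟨⟨j, hA⟩, h⟩)
      · exact ⟨(x, j), hA, Or.inl ⟨rfl, h⟩⟩
      · exact ⟨(y, j), hA, Or.inr ⟨rfl, h⟩⟩
  rw [key]
  split_ifs with h
  · exact card_quot_of_transitive (finRotate n) R (fun x => Or.inl ⟨h x, rfl⟩)
      exists_finRotate_iterate_eq
  · push Not at h
    obtain ⟨i, hi⟩ := h
    rw [card_quot_of_orbits_leave (finRotate n) B R (fun _ _ => Iff.rfl)]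
    · have : (Bᶜ : Set (Fin n)) =
          ((univ.filter fun i => finsetProdEquiv _ _ A i = ∅ : Finset (Fin n)) : Set (Fin n)) := by
        ext; simp [hB]
      rw [this]
      simp
    · intro x
      obtain ⟨k, hk⟩ := exists_finRotate_iterate_eq x i
      exact ⟨k, by rw [hk]; simp [hB, hi]⟩

/-- The dichromatic polynomial of the cycle with all edges replaced by `r` parallel edges. -/
theorem dichromatic_cycle_expansion {n : ℕ} (hn : n ≠ 0) (r : ℕ) (q v : ℂ) :
    ((cycleMultigraph n).parallelExpansion r).dichromatic q v =
      (q + ((1 + v) ^ r - 1)) ^ n + (q - 1) * ((1 + v) ^ r - 1) ^ n := by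
  classical
  have hE : E((cycleMultigraph n).parallelExpansion r) = Set.univ :=
    Set.eq_univ_of_forall fun e => ⟨e.1, finRotate n e.1, Or.inl ⟨rfl, rfl⟩⟩
  -- The first product carries `q ^ 0` when no fibre is empty; the second is nonzero only then, and
  -- `1 + (q - 1) = q` repairs the exponent.
  have hterm : ∀ A : Finset (Fin n × Fin r),
      q ^ (((cycleMultigraph n).parallelExpansion r).restrict
        (A : Set (Fin n × Fin r))).componentCount * v ^ #A =
      ∏ i, ((if finsetProdEquiv _ _ A i = ∅ then q else 1) * v ^ #(finsetProdEquiv _ _ A i)) +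
      (q - 1) * ∏ i, ((if finsetProdEquiv _ _ A i = ∅ then 0 else 1) *
        v ^ #(finsetProdEquiv _ _ A i)) := by
    intro A
    rw [componentCount_restrict_cycle_expansion hn, pow_card_eq_prod_fibres,
      Finset.prod_mul_distrib, Finset.prod_mul_distrib, ← mul_assoc, ← add_mul]
    congr 1
    split_ifs with h
    · rw [Finset.prod_congr rfl fun i _ => if_neg (h i),
        Finset.prod_congr rfl fun i _ => if_neg (h i)]
      simp
    · push Not at h
      obtain ⟨i, hi⟩ := h
      rw [Finset.prod_eq_zero (f := fun i => if finsetProdEquiv _ _ A i = ∅ then (0 : ℂ) else 1)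
        (mem_univ i) (if_pos hi), mul_zero, add_zero, Finset.prod_ite]
      simp
  have hw : ∑ S : Finset (Fin r), ((if S = ∅ then 0 else 1) * v ^ #S) = (1 + v) ^ r - 1 := by
    have h1 := sum_pow_card_finset (Fin r) v
    have h2 : ∑ S : Finset (Fin r), (if S = ∅ then v ^ #S else 0) = 1 := by simp
    rw [Fintype.card_fin] at h1
    rw [← h1, ← h2, ← Finset.sum_sub_distrib]
    exact Finset.sum_congr rfl fun S _ => by split_ifs <;> simp
  have hq : ∑ S : Finset (Fin r), ((if S = ∅ then q else 1) * v ^ #S) =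
      q + ((1 + v) ^ r - 1) := by
    have h2 : ∑ S : Finset (Fin r), (if S = ∅ then q * v ^ #S else 0) = q := by simp
    rw [← hw, ← h2, ← Finset.sum_add_distrib]
    exact Finset.sum_congr rfl fun S _ => by split_ifs <;> simp_all
  unfold Graph.dichromatic Graph.pottsPartition
  simp only [hE, Set.toFinset_univ, Finset.powerset_univ, Finset.prod_const]
  simp_rw [hterm]
  rw [Finset.sum_add_distrib, ← Finset.mul_sum,
    sum_finset_prod_fibres fun S => (if S = ∅ then q else 1) * v ^ #S,
    sum_finset_prod_fibres fun S => (if S = ∅ then 0 else 1) * v ^ #S, hw, hq, Fintype.card_fin]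

/-! ### Complex roots and the limiting line of zeros -/

/-- Every complex number has an `n`-th root whose argument is within `π / n` of a given one. -/
theorem exists_pow_eq_norm_sub_le {n : ℕ} (hn : n ≠ 0) (y z₀ : ℂ) :
    ∃ z : ℂ, z ^ n = y ∧ ‖z - z₀‖ ≤
      |‖y‖ ^ (1 / n : ℝ) - ‖z₀‖| + ‖y‖ ^ (1 / n : ℝ) * (Real.pi / n) := by
  have hn' : (0 : ℝ) < n := by positivity
  have hpi := Real.pi_pos
  set ρ : ℝ := ‖y‖ ^ (1 / n : ℝ) with hρ
  have hρ0 : 0 ≤ ρ := by positivity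
  have hρn : ρ ^ n = ‖y‖ := by
    rw [hρ, one_div, Real.rpow_inv_natCast_pow (norm_nonneg y) hn]
  set θ := z₀.arg
  set φ := y.arg
  -- The arguments of the `n`-th roots are `2π / n` apart; `k` selects the one nearest to `θ`.
  set k : ℤ := round ((n * θ - φ) / (2 * Real.pi))
  set ψ : ℝ := (φ + 2 * Real.pi * k) / n with hψ
  have hψθ : |ψ - θ| ≤ Real.pi / n := by
    have h1 := abs_sub_round ((n * θ - φ) / (2 * Real.pi))
    have h2 : ψ - θ = -((n * θ - φ) / (2 * Real.pi) - k) * (2 * Real.pi / n) := by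
      rw [hψ]; field_simp; ring
    rw [h2, abs_mul, abs_neg, abs_of_pos (by positivity : 0 < 2 * Real.pi / (n : ℝ))]
    calc _ ≤ 1 / 2 * (2 * Real.pi / n) := by gcongr
      _ = _ := by ring
  refine ⟨ρ * Complex.exp (ψ * Complex.I), ?_, ?_⟩
  · rw [mul_pow, ← Complex.exp_nat_mul, ← Complex.ofReal_pow, hρn]
    have : (n : ℂ) * (ψ * Complex.I) = φ * Complex.I + k * (2 * Real.pi * Complex.I) := by
      have : (n : ℂ) ≠ 0 := Nat.cast_ne_zero.2 hn
      rw [hψ]; push_cast; field_simp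
    rw [this, Complex.exp_add, Complex.exp_int_mul_two_pi_mul_I, mul_one,
      Complex.norm_mul_exp_arg_mul_I]
  · have hz : z₀ = ‖z₀‖ * Complex.exp (θ * Complex.I) := (Complex.norm_mul_exp_arg_mul_I z₀).symm
    -- A rotation at radius `ρ` plus a radial displacement.
    have hdec : (ρ : ℂ) * Complex.exp (ψ * Complex.I) - z₀ =
        ρ * (Complex.exp (θ * Complex.I) * (Complex.exp (Complex.I * ((ψ - θ : ℝ) : ℂ)) - 1)) +
        ((ρ - ‖z₀‖ : ℝ) : ℂ) * Complex.exp (θ * Complex.I) := by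
      have : Complex.exp (ψ * Complex.I) =
          Complex.exp (θ * Complex.I) * Complex.exp (Complex.I * ((ψ - θ : ℝ) : ℂ)) := by
        rw [← Complex.exp_add]; congr 1; push_cast; ring
      conv_lhs => rw [hz]
      rw [this]; push_cast; ring
    rw [hdec, add_comm |ρ - ‖z₀‖|]
    refine (norm_add_le _ _).trans ?_
    rw [norm_mul, norm_mul, norm_mul, Complex.norm_exp_ofReal_mul_I, Complex.norm_real,
      Complex.norm_real, mul_one, one_mul, Real.norm_of_nonneg hρ0, Real.norm_eq_abs]
    gcongr
    exact (Real.norm_exp_I_mul_ofReal_sub_one_le).trans hψθ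

theorem tendsto_rpow_one_div_natCast {a : ℝ} (ha : 0 < a) :
    Tendsto (fun n : ℕ => a ^ (1 / n : ℝ)) atTop (𝓝 1) := by
  have h : Tendsto (fun n : ℕ => (1 / n : ℝ)) atTop (𝓝 0) := tendsto_one_div_atTop_nhds_zero_nat
  simpa using (tendsto_const_nhds (x := a)).rpow h (Or.inl ha.ne')

/-- The `n`-th roots of a nonzero number accumulate at every point of the unit circle. -/
theorem exists_roots_tendsto {a t₀ : ℂ} (ha : a ≠ 0) (ht₀ : ‖t₀‖ = 1) :
    ∃ t : ℕ → ℂ, (∀ n ≠ 0, t n ^ n = a) ∧ Tendsto t atTop (𝓝 t₀) := by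
  choose! t ht using fun (n : ℕ) (hn : n ≠ 0) => exists_pow_eq_norm_sub_le hn a t₀
  refine ⟨t, fun n hn => (ht n hn).1, ?_⟩
  rw [tendsto_iff_norm_sub_tendsto_zero]
  have h1 := tendsto_rpow_one_div_natCast (norm_pos_iff.2 ha)
  have h2 : Tendsto (fun n : ℕ => |‖a‖ ^ (1 / n : ℝ) - ‖t₀‖| +
      ‖a‖ ^ (1 / n : ℝ) * (Real.pi / n)) atTop (𝓝 0) := by
    have := ((h1.sub_const ‖t₀‖).abs).add (h1.mul (tendsto_const_div_atTop_nhds_zero_nat Real.pi))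
    simpa [ht₀] using this
  refine squeeze_zero' (Eventually.of_forall fun _ => norm_nonneg _) ?_ h2
  filter_upwards [eventually_ne_atTop 0] with n hn using (ht n hn).2

/-- The perpendicular bisector of `1` and `1 - q` meets every large circle around the origin. -/
theorem exists_norm_bisector_eq {q : ℂ} (hq : q ≠ 0) {M : ℝ} (hM : ‖1 - q / 2‖ ≤ M) :
    ∃ s : ℝ, ‖1 - q / 2 + s * Complex.I * q‖ = M := by
  have hcont : Continuous fun s : ℝ => ‖1 - q / 2 + s * Complex.I * q‖ := by fun_prop
  have hqpos := norm_pos_iff.2 hq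
  set b : ℝ := (M + ‖1 - q / 2‖) / ‖q‖
  have hb : 0 ≤ b := div_nonneg (add_nonneg ((norm_nonneg _).trans hM) (norm_nonneg _)) hqpos.le
  have hlarge : M ≤ ‖1 - q / 2 + b * Complex.I * q‖ := by
    have h1 : ‖(b : ℂ) * Complex.I * q‖ = M + ‖1 - q / 2‖ := by
      rw [norm_mul, norm_mul, Complex.norm_I, Complex.norm_real, Real.norm_of_nonneg hb, mul_one,
        div_mul_cancel₀ _ hqpos.ne']
    have h2 := norm_sub_le (1 - q / 2 + b * Complex.I * q) (1 - q / 2)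
    rw [add_sub_cancel_left, h1] at h2
    linarith
  obtain ⟨s, -, hs⟩ := intermediate_value_Icc hb hcont.continuousOn ⟨by simpa using hM, hlarge⟩
  exact ⟨s, hs⟩

/-- Every point of the perpendicular bisector of `1` and `1 - q` is the limit of values
`1 + w` with `(q + w) ^ n + (q - 1) * w ^ n = 0`. -/
theorem exists_zeros_tendsto_bisector {q : ℂ} (hq₁ : q ≠ 1) (s : ℝ) :
    ∃ y : ℕ → ℂ, Tendsto y atTop (𝓝 (1 - q / 2 + s * Complex.I * q)) ∧
      ∀ᶠ n in atTop, (q + (y n - 1)) ^ n + (q - 1) * (y n - 1) ^ n = 0 := by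
  -- Here `w = q * d` and `t₀ = (q + w) / w`; `Re d = -1/2` means `1 + d = -conj d`, whence `‖t₀‖ =
  -- 1`.
  set d : ℂ := -1 / 2 + s * Complex.I with hd
  have hd0 : d ≠ 0 := by
    intro h
    have := congrArg Complex.re h
    norm_num [hd] at this
  set t₀ : ℂ := (1 + d) / d with ht₀
  have hnorm : ‖t₀‖ = 1 := by
    have : 1 + d = -(starRingEnd ℂ) d := by
      apply Complex.ext <;> norm_num [hd]
    rw [ht₀, this, norm_div, norm_neg, RCLike.norm_conj, div_self (norm_ne_zero_iff.2 hd0)]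
  have hsub : t₀ - 1 = 1 / d := by rw [ht₀]; field_simp; ring
  have hne : t₀ ≠ 1 := by
    rw [← sub_ne_zero, hsub]; exact one_div_ne_zero hd0
  obtain ⟨t, ht, hlim⟩ := exists_roots_tendsto (sub_ne_zero.2 hq₁.symm) hnorm
  -- Solve `(q + w) / w = t n` for `w`.
  refine ⟨fun n => 1 + q / (t n - 1), ?_, ?_⟩
  · have := ((tendsto_const_nhds (x := q)).div (hlim.sub_const 1)
      (sub_ne_zero.2 hne)).const_add 1
    have hval : 1 + q / (t₀ - 1) = 1 - q / 2 + s * Complex.I * q := by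
      rw [hsub, div_div_eq_mul_div, div_one, hd]; ring
    rwa [hval] at this
  · filter_upwards [hlim.eventually_ne hne, eventually_ne_atTop 0] with n h1 hn
    have h1' : t n - 1 ≠ 0 := sub_ne_zero.2 h1
    have h2 : q + (1 + q / (t n - 1) - 1) = t n * (1 + q / (t n - 1) - 1) := by
      field_simp; ring
    rw [h2, mul_pow, ht n hn]
    ring

theorem theorem7p1 (q₀ v₀ : ℂ) (hq₀ : q₀ ≠ 0) (hq₁ : q₀ ≠ 1) (hv₀ : 1 ≤ ‖1 + v₀‖)
    (ε : ℝ) (hε : 0 < ε) :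
    ∃ (r₀ : ℕ) (n₀ : ℕ → ℕ), ∀ r : ℕ, r₀ ≤ r → ∀ n : ℕ, n₀ r ≤ n →
      ∃ v : ℂ, ‖v - v₀‖ < ε ∧
        ((cycleMultigraph n).parallelExpansion r).dichromatic q₀ v = 0 := by
  -- The excess `ε / 4` forces `ρ ^ r → ∞` even if `‖1 + v₀‖ = 1`; the radial and angular errors
  -- then total less than `ε / 2`.
  set ρ : ℝ := ‖1 + v₀‖ + ε / 4 with hρ
  have hρ1 : 1 < ρ := by linarith
  have hr : ∀ᶠ r : ℕ in atTop, ‖1 - q₀ / 2‖ ≤ ρ ^ r ∧ ρ * (Real.pi / r) < ε / 4 ∧ r ≠ 0 := by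
    have h1 := (tendsto_pow_atTop_atTop_of_one_lt hρ1).eventually_ge_atTop ‖1 - q₀ / 2‖
    have h2 : Tendsto (fun r : ℕ => ρ * (Real.pi / r)) atTop (𝓝 0) := by
      simpa using (tendsto_const_div_atTop_nhds_zero_nat Real.pi).const_mul ρ
    exact h1.and ((h2.eventually_lt_const (by positivity)).and (eventually_ne_atTop 0))
  obtain ⟨r₀, hr₀⟩ := eventually_atTop.1 hr
  have hn : ∀ r, r₀ ≤ r → ∃ N : ℕ, ∀ n : ℕ, N ≤ n → ∃ v : ℂ, ‖v - v₀‖ < ε ∧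
      ((cycleMultigraph n).parallelExpansion r).dichromatic q₀ v = 0 := by
    intro r hr
    obtain ⟨hM, hsmall, hr0⟩ := hr₀ r hr
    obtain ⟨s, hs⟩ := exists_norm_bisector_eq hq₀ hM
    obtain ⟨y, hy, hzero⟩ := exists_zeros_tendsto_bisector hq₁ s
    have hroot : Tendsto (fun n => ‖y n‖ ^ (1 / r : ℝ)) atTop (𝓝 ρ) := by
      have h := hy.norm.rpow_const (p := (1 / r : ℝ)) (Or.inr (by positivity))
      rwa [hs, one_div, Real.pow_rpow_inv_natCast (by linarith) hr0, ← one_div] at h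
    have hbound : Tendsto (fun n => |‖y n‖ ^ (1 / r : ℝ) - ‖1 + v₀‖| +
        ‖y n‖ ^ (1 / r : ℝ) * (Real.pi / r)) atTop
        (𝓝 (|ρ - ‖1 + v₀‖| + ρ * (Real.pi / r))) :=
      (hroot.sub_const _).abs.add (hroot.mul_const _)
    have hlt : |ρ - ‖1 + v₀‖| + ρ * (Real.pi / r) < ε := by
      rw [hρ, add_sub_cancel_left, abs_of_pos (by positivity), ← hρ]
      linarith
    refine eventually_atTop.1 ?_
    filter_upwards [hbound.eventually_lt_const hlt, hzero, eventually_ne_atTop 0] with n hb hz hn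
    obtain ⟨z, hzr, hzn⟩ := exists_pow_eq_norm_sub_le hr0 (y n) (1 + v₀)
    refine ⟨z - 1, ?_, ?_⟩
    · rw [show z - 1 - v₀ = z - (1 + v₀) by ring]
      exact hzn.trans_lt hb
    · rw [dichromatic_cycle_expansion hn, add_sub_cancel, hzr, hz]
  choose! n₀ hn₀ using hn
  exact ⟨r₀, n₀, hn₀⟩
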